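/- Let $L_1, L_2, \dots$ be natural numbers, let $\mathcal{A} = \prod_{j=1}^\infty \{1,\dots,L_j\}$ with its Borel $\sigma$-algebra, and let $X_j(a) = a_j$ be the coordinate functions on $\mathcal{A}$. Let $\mathcal{X} = \bigcap_{n} \sigma(X_n, X_{n+1}, \dots)$ be the tail $\sigma$-algebra on $\mathcal{A}$. Let $P$ be the set of all real vectors $\beta = (\beta_{jl})_{j \ge 1,\, 1 \le l \le L_j}$ with $0 \le \beta_{jl} \le 1$ for all $j, l$ and $\sum_{l=1}^{L_j} \beta_{jl} = 1$ for all $j$. For $\beta \in P$ let $\mathsf{P}_\beta$ be the probability measure on $\mathcal{A}$ under which the $X_j$ are mutually independent and $X_j = l$ has probability $\beta_{jl}$. Let $\lambda^1, \dots, \lambda^K \in P$ be linearly independent, let $\mathcal{L}$ be their linear span and $P_0 = P \cap \mathcal{L}$. For $g \in \mathbb{R}^K$ put $\beta(g) = \sum_{k=1}^K g_k \lambda^k$, let $Q = \{ g \in \mathbb{R}^K : \beta(g) \in P_0 \}$ with its Borel $\sigma$-algebra $\mathcal{B}(Q)$, and write $\mathsf{P}_g = \mathsf{P}_{\beta(g)}$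 for $g \in Q$. Suppose that $\mathsf{P}_{g'} \perp \mathsf{P}_{g''}$ (mutually singular) for all $g', g'' \in Q$ with $g' \neq g''$. Then for every Borel probability measure $\mu$ on $Q$ there exist a Borel set $Q_1 \subseteq Q$ with $\mu(Q_1) = 1$ and a map $\varphi : \mathcal{A} \to Q$ that is measurable from $(\mathcal{A}, \mathcal{X})$ to $(Q, \mathcal{B}(Q))$, such that $Q_1 \subseteq \varphi(\mathcal{A})$ and $\mathsf{P}_g(\varphi^{-1}(\{g\})) = 1$ for every $g \in Q_1$. -/

import Mathlib

open MeasureTheory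

namespace IndepMixture

/-- The space `ℝ^∞` of vectors `β = (β_{jl})`, where `j` is the index of a variable and
`l` one of its `L j` values. -/
abbrev ParamSpace (L : ℕ → ℕ) : Type := (j : ℕ) → Fin (L j) → ℝ

/-- The space `𝒜 = ∏_j {1, …, L_j}` of outcomes. Its default `σ`-algebra is the product of the
discrete ones, that is, the one generated by the coordinates `X_j`, which is the Borel one. -/
abbrev Outcomes (L : ℕ → ℕ) : Type := (j : ℕ) → Fin (L j)

/-- The convex body `P` of vectors `β` with `0 ≤ β_{jl} ≤ 1` and `∑_l β_{jl} = 1`. -/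
def body (L : ℕ → ℕ) : Set (ParamSpace L) :=
  {β | (∀ j l, 0 ≤ β j l ∧ β j l ≤ 1) ∧ ∀ j, ∑ l, β j l = 1}

/-- The distribution of the single variable `X_j`: the value `l` has probability `β_{jl}`. -/
noncomputable def coordMeasure {L : ℕ → ℕ} (β : ParamSpace L) (j : ℕ) : Measure (Fin (L j)) :=
  ∑ l, ENNReal.ofReal (β j l) • Measure.dirac l

theorem isProbabilityMeasure_coordMeasure {L : ℕ → ℕ} {β : ParamSpace L} (hβ : β ∈ body L)
    (j : ℕ) : IsProbabilityMeasure (coordMeasure β j) := by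
  constructor
  simp only [coordMeasure, Measure.coe_finsetSum, Finset.sum_apply, Measure.smul_apply,
    measure_univ, smul_eq_mul, mul_one]
  rw [← ENNReal.ofReal_sum_of_nonneg (fun l _ => (hβ.1 j l).1), hβ.2 j, ENNReal.ofReal_one]

/-- The independent distribution `P_β` on `𝒜`: the product of the distributions of the single
variables. It is used for `β` in `body L` only. -/
noncomputable def indepMeasure {L : ℕ → ℕ} (β : ParamSpace L) : Measure (Outcomes L) :=
  Measure.infinitePi (coordMeasure β)

/-- The linear map `g ↦ β(g) = ∑_k g_k λ^k`. -/
def combine {L : ℕ → ℕ} {K : ℕ} (lam : Fin K → ParamSpace L) (g : Fin K → ℝ) : ParamSpace L :=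
  ∑ k, g k • lam k

/-- The section `P_0 = P ∩ ℒ` of the body `P` by the subspace `ℒ` spanned by the `λ^k`. -/
def section₀ {L : ℕ → ℕ} {K : ℕ} (lam : Fin K → ParamSpace L) : Set (ParamSpace L) :=
  body L ∩ (Submodule.span ℝ (Set.range lam) : Set (ParamSpace L))

/-- The set `Q ⊆ ℝ^K` of the coordinates of the points of `P_0` in the basis `λ^1, …, λ^K`. -/
def paramSet {L : ℕ → ℕ} {K : ℕ} (lam : Fin K → ParamSpace L) : Set (Fin K → ℝ) :=
  {g | combine lam g ∈ section₀ lam}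

/-- The independent distribution `P_g = P_{β(g)}`, for `g ∈ Q`. -/
noncomputable def mixComponent {L : ℕ → ℕ} {K : ℕ} (lam : Fin K → ParamSpace L)
    (g : paramSet lam) : Measure (Outcomes L) :=
  indepMeasure (combine lam g)

/-- The `σ`-algebra `σ(X_n, X_{n+1}, …)` on `𝒜`. -/
@[reducible] def fromIndex (L : ℕ → ℕ) (n : ℕ) : MeasurableSpace (Outcomes L) :=
  ⨆ (j : ℕ) (_ : n ≤ j), MeasurableSpace.comap (fun a : Outcomes L => a j) inferInstance

/-- The tail `σ`-algebra `𝒳 = ⋂_n σ(X_n, X_{n+1}, …)` on `𝒜`. -/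
@[reducible] def tail (L : ℕ → ℕ) : MeasurableSpace (Outcomes L) :=
  ⨅ n, fromIndex L n

end IndepMixture

namespace IndepMixture

open Filter Topology ENNReal ProbabilityTheory

variable {L : ℕ → ℕ} {K : ℕ}

/-! Singularity forces the data to carry infinite information in every direction, and infinite
information yields a consistent estimator depending only on the tail. If the Fisher information
`info lam j v` were summable in `j` for some `v ≠ 0`, likelihood ratios between the barycentre and a
nearby point in direction `v` would have bounded second moments, contradicting singularity
(`not_summable_info`). By compactness, finite blocks starting at any `n` therefore carry information
at least `2 ^ n` in all directions at once (`exists_block_info`). Inverting the information form of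
such a block gives a linear unbiased estimator of `g_k` with variance at most `‖g‖ / 2 ^ n`
(`exists_infoForm_eq`, `variance_linStat_le`). These converge almost surely to `g_k`, and their
limsup is tail measurable. This works for every `g` simultaneously, so all of `Q` serves as `Q₁`. -/

theorem coordMeasure_singleton (β : ParamSpace L) (j : ℕ) (l : Fin (L j)) :
    coordMeasure β j {l} = ENNReal.ofReal (β j l) := by
  classical
  simp only [coordMeasure, Measure.coe_finsetSum, Finset.sum_apply, Measure.smul_apply,
    smul_eq_mul]
  rw [Finset.sum_eq_single l]
  · simp
  · intro b _ hb
    simp [hb]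
  · simp

theorem integral_coordMeasure {β : ParamSpace L} (hβ : β ∈ body L) (j : ℕ) (f : Fin (L j) → ℝ) :
    ∫ l, f l ∂coordMeasure β j = ∑ l, β j l * f l := by
  have := isProbabilityMeasure_coordMeasure hβ j
  rw [integral_fintype Integrable.of_finite]
  refine Finset.sum_congr rfl fun l _ => ?_
  rw [measureReal_def, coordMeasure_singleton, ENNReal.toReal_ofReal (hβ.1 j l).1, smul_eq_mul]

theorem isProbabilityMeasure_indepMeasure {β : ParamSpace L} (hβ : β ∈ body L) :
    IsProbabilityMeasure (indepMeasure β) := by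
  have := isProbabilityMeasure_coordMeasure hβ
  unfold indepMeasure
  infer_instance

/-! ### Likelihood ratios and non-singularity -/

theorem indepMeasure_real_cylinder {β : ParamSpace L} (hβ : β ∈ body L) (s : Finset ℕ)
    (S : Finset ((j : s) → Fin (L j))) :
    (indepMeasure β).real (cylinder s (S : Set ((j : s) → Fin (L j)))) =
      ∑ x ∈ S, ∏ j : s, β j (x j) := by
  have := isProbabilityMeasure_coordMeasure hβ
  rw [measureReal_def, indepMeasure, Measure.infinitePi_cylinder _ S.measurableSet,
    ← measureReal_def, ← sum_measureReal_singleton]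
  refine Finset.sum_congr rfl fun x _ => ?_
  rw [measureReal_def, Measure.pi_singleton, ENNReal.toReal_prod]
  refine Finset.prod_congr rfl fun j _ => ?_
  rw [coordMeasure_singleton, ENNReal.toReal_ofReal (hβ.1 j _).1]

/-- The Cauchy-Schwarz inequality for the likelihood ratio of `P_γ` with respect to `P_β` on a
cylinder. -/
theorem sq_indepMeasure_real_cylinder_le {β γ : ParamSpace L} (hβ : β ∈ body L) (hγ : γ ∈ body L)
    (hac : ∀ j l, β j l = 0 → γ j l = 0) {M : ℝ}
    (hM : ∀ s : Finset ℕ, ∏ j ∈ s, ∑ l, γ j l ^ 2 / β j l ≤ M)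
    {t : Set (Outcomes L)} (ht : t ∈ measurableCylinders fun j => Fin (L j)) :
    (indepMeasure γ).real t ^ 2 ≤ (indepMeasure β).real t * M := by
  classical
  obtain ⟨s, S, -, rfl⟩ := (mem_measurableCylinders t).1 ht
  obtain ⟨S, rfl⟩ := S.toFinite.exists_finset_coe
  rw [indepMeasure_real_cylinder hβ, indepMeasure_real_cylinder hγ]
  have h0 : ∀ x : (j : s) → Fin (L j), 0 ≤ ∏ j : s, β j (x j) :=
    fun x => Finset.prod_nonneg fun j _ => (hβ.1 j _).1
  have h1 : ∀ x : (j : s) → Fin (L j), 0 ≤ ∏ j : s, (γ j (x j) ^ 2 / β j (x j)) :=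
    fun x => Finset.prod_nonneg fun j _ => div_nonneg (sq_nonneg _) (hβ.1 j _).1
  refine (Finset.sum_sq_le_sum_mul_sum_of_sq_le_mul S (f := fun x => ∏ j : s, β j (x j))
    (g := fun x => ∏ j : s, (γ j (x j) ^ 2 / β j (x j))) (fun x _ => h0 x) (fun x _ => h1 x)
    fun x _ => ?_).trans ?_
  · rw [← Finset.prod_mul_distrib, ← Finset.prod_pow]
    apply le_of_eq
    refine Finset.prod_congr rfl fun j _ => ?_
    by_cases h : β j (x j) = 0
    · simp [h, hac _ _ h]
    · field_simp
  · refine mul_le_mul_of_nonneg_left ?_ (Finset.sum_nonneg fun x _ => h0 x)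
    refine (Finset.sum_le_univ_sum_of_nonneg h1).trans ((hM s).trans' (le_of_eq ?_))
    rw [← Finset.prod_coe_sort s (fun j => ∑ l, γ j l ^ 2 / β j l), Fintype.prod_sum]

/-- A separating set could be approximated by a cylinder of small `P_β`-measure and `P_γ`-measure
near 1, against the Cauchy-Schwarz bound. -/
theorem not_mutuallySingular_of_prod_le {β γ : ParamSpace L} (hβ : β ∈ body L) (hγ : γ ∈ body L)
    (hac : ∀ j l, β j l = 0 → γ j l = 0) {M : ℝ}
    (hM : ∀ s : Finset ℕ, ∏ j ∈ s, ∑ l, γ j l ^ 2 / β j l ≤ M) :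
    ¬ (indepMeasure β).MutuallySingular (indepMeasure γ) := by
  rintro ⟨A, hA, hA0, hA1⟩
  have := isProbabilityMeasure_indepMeasure hβ
  have := isProbabilityMeasure_indepMeasure hγ
  have hM1 : 1 ≤ M := by simpa using hM ∅
  -- Small enough that `(1 - ε) ^ 2 > ε * M`.
  set ε : ℝ := 1 / (M + 3) with hε
  have hεpos : 0 < ε := by positivity
  -- Density for the sum gives one cylinder that is good for both measures.
  have hdense : (indepMeasure β + indepMeasure γ).MeasureDense
      (measurableCylinders fun j => Fin (L j)) :=
    Measure.MeasureDense.of_generateFrom_isSetAlgebra_finite _ isSetAlgebra_measurableCylinders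
      generateFrom_measurableCylinders.symm
  obtain ⟨t, ht, hAt⟩ := hdense.approx A hA (measure_ne_top _ _) ε hεpos
  rw [Measure.add_apply] at hAt
  have hsmall : ∀ (ν : Measure (Outcomes L)) [IsProbabilityMeasure ν],
      ν (symmDiff A t) < ENNReal.ofReal ε → ν.real (A \ t) ≤ ε ∧ ν.real (t \ A) ≤ ε := by
    intro ν _ h
    have h' : ν.real (symmDiff A t) ≤ ε := by
      rw [measureReal_def]
      exact ENNReal.toReal_le_of_le_ofReal hεpos.le h.le
    exact ⟨(measureReal_mono (by rw [Set.symmDiff_def]; exact Set.subset_union_left)).trans h',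
      (measureReal_mono (by rw [Set.symmDiff_def]; exact Set.subset_union_right)).trans h'⟩
  have hb := (hsmall (indepMeasure β) (lt_of_le_of_lt le_self_add hAt)).2
  have hc := (hsmall (indepMeasure γ) (lt_of_le_of_lt le_add_self hAt)).1
  have hA0' : (indepMeasure β).real A = 0 := by simp [measureReal_def, hA0]
  have hA1' : (indepMeasure γ).real Aᶜ = 0 := by simp [measureReal_def, hA1]
  have h1 : (indepMeasure β).real t ≤ ε := by
    have h := measureReal_mono (μ := indepMeasure β) (s₁ := t) (s₂ := A ∪ t \ A) (by simp)
    linarith [measureReal_union_le (μ := indepMeasure β) A (t \ A)]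
  have h2 : 1 - ε ≤ (indepMeasure γ).real t := by
    have h := measureReal_mono (μ := indepMeasure γ) (s₁ := A) (s₂ := t ∪ A \ t) (by simp)
    rw [probReal_compl_eq_one_sub hA] at hA1'
    linarith [measureReal_union_le (μ := indepMeasure γ) t (A \ t)]
  have h3 := sq_indepMeasure_real_cylinder_le hβ hγ hac hM ht
  have h4 : ε * (M + 3) = 1 := by rw [hε]; field_simp
  have h5 : ε ≤ 1 := by nlinarith
  nlinarith [mul_le_mul_of_nonneg_right h1 (by linarith : (0 : ℝ) ≤ M)]

/-! ### The parameter set and Fisher information -/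

theorem combine_apply (lam : Fin K → ParamSpace L) (g : Fin K → ℝ) (j : ℕ) (l : Fin (L j)) :
    combine lam g j l = ∑ k, g k * lam k j l := by
  simp [combine, Finset.sum_apply]

theorem mem_paramSet_iff (lam : Fin K → ParamSpace L) (g : Fin K → ℝ) :
    g ∈ paramSet lam ↔ combine lam g ∈ body L :=
  ⟨fun h => h.1, fun h => ⟨h, Submodule.sum_mem _ fun k _ =>
    Submodule.smul_mem _ _ (Submodule.subset_span ⟨k, rfl⟩)⟩⟩

theorem mem_body_iff (β : ParamSpace L) :
    β ∈ body L ↔ (∀ j l, 0 ≤ β j l) ∧ ∀ j, ∑ l, β j l = 1 := by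
  refine ⟨fun h => ⟨fun j l => (h.1 j l).1, h.2⟩, fun h => ⟨fun j l => ⟨h.1 j l, ?_⟩, h.2⟩⟩
  rw [← h.2 j]
  exact Finset.single_le_sum (fun l _ => h.1 j l) (Finset.mem_univ l)

theorem sum_combine {lam : Fin K → ParamSpace L} (hmem : ∀ k, lam k ∈ body L) (g : Fin K → ℝ)
    (j : ℕ) : ∑ l, combine lam g j l = ∑ k, g k := by
  simp_rw [combine_apply]
  rw [Finset.sum_comm]
  refine Finset.sum_congr rfl fun k _ => ?_
  rw [← Finset.mul_sum, (hmem k).2 j, mul_one]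

theorem measurableSet_paramSet (lam : Fin K → ParamSpace L) : MeasurableSet (paramSet lam) := by
  have : paramSet lam = (⋂ (j : ℕ) (l : Fin (L j)), {g | 0 ≤ ∑ k, g k * lam k j l}) ∩
      ⋂ j : ℕ, {g | ∑ l : Fin (L j), ∑ k, g k * lam k j l = 1} := by
    ext g
    simp [mem_paramSet_iff, mem_body_iff, combine_apply]
  rw [this]
  refine (MeasurableSet.iInter fun j => MeasurableSet.iInter fun l => ?_).inter
    (MeasurableSet.iInter fun j => ?_)
  · exact measurableSet_le measurable_const (by fun_prop)
  · exact measurableSet_eq_fun (by fun_prop) measurable_const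

/-- The sum `∑_k λ^k`, which dominates all the points of `P_0` up to constants. -/
def weight (lam : Fin K → ParamSpace L) (j : ℕ) (l : Fin (L j)) : ℝ := ∑ k, lam k j l

/-- The Fisher information of `X_j` at the barycentre of the `λ^k`, up to the factor `K`, as a
quadratic form. -/
noncomputable def info (lam : Fin K → ParamSpace L) (j : ℕ) (v : Fin K → ℝ) : ℝ :=
  ∑ l, combine lam v j l ^ 2 / weight lam j l

section Weight

variable {lam : Fin K → ParamSpace L} (hmem : ∀ k, lam k ∈ body L)
include hmem

theorem weight_nonneg (j : ℕ) (l : Fin (L j)) : 0 ≤ weight lam j l :=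
  Finset.sum_nonneg fun k _ => ((hmem k).1 j l).1

theorem sum_weight (j : ℕ) : ∑ l, weight lam j l = K := by
  unfold weight
  rw [Finset.sum_comm]
  simp [(hmem _).2 j]

theorem abs_combine_le (g : Fin K → ℝ) (j : ℕ) (l : Fin (L j)) :
    |combine lam g j l| ≤ ‖g‖ * weight lam j l := by
  rw [combine_apply, weight, Finset.mul_sum]
  refine (Finset.abs_sum_le_sum_abs _ _).trans (Finset.sum_le_sum fun k _ => ?_)
  rw [abs_mul, abs_of_nonneg ((hmem k).1 j l).1]
  exact mul_le_mul_of_nonneg_right (norm_le_pi_norm g k) ((hmem k).1 j l).1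

theorem combine_eq_zero_of_weight_eq_zero (g : Fin K → ℝ) {j : ℕ} {l : Fin (L j)}
    (h : weight lam j l = 0) : combine lam g j l = 0 := by
  have := abs_combine_le hmem g j l
  rw [h, mul_zero] at this
  exact abs_nonpos_iff.1 this

theorem info_nonneg (j : ℕ) (v : Fin K → ℝ) : 0 ≤ info lam j v :=
  Finset.sum_nonneg fun l _ => div_nonneg (sq_nonneg _) (weight_nonneg hmem j l)

/-- Cauchy-Schwarz over the values of `X_j`. It handles directions transverse to the hyperplane `∑
k, v k = 0`, where the information of each variable is bounded below. -/
theorem sq_sum_le_info (j : ℕ) (v : Fin K → ℝ) : (∑ k, v k) ^ 2 ≤ info lam j v * K := by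
  rw [← sum_combine hmem v j, ← sum_weight hmem j]
  refine Finset.sum_sq_le_sum_mul_sum_of_sq_le_mul _
    (fun l _ => div_nonneg (sq_nonneg _) (weight_nonneg hmem j l))
    (fun l _ => weight_nonneg hmem j l) fun l _ => ?_
  apply le_of_eq
  by_cases h : weight lam j l = 0
  · simp [h, combine_eq_zero_of_weight_eq_zero hmem v h]
  · field_simp

end Weight

theorem mem_paramSet_of_nonneg {lam : Fin K → ParamSpace L} (hmem : ∀ k, lam k ∈ body L)
    {g : Fin K → ℝ} (h0 : ∀ k, 0 ≤ g k) (h1 : ∑ k, g k = 1) : g ∈ paramSet lam := by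
  rw [mem_paramSet_iff, mem_body_iff]
  refine ⟨fun j l => ?_, fun j => by rw [sum_combine hmem, h1]⟩
  rw [combine_apply]
  exact Finset.sum_nonneg fun k _ => mul_nonneg (h0 k) ((hmem k).1 j l).1

theorem combine_const (lam : Fin K → ParamSpace L) (c : ℝ) (j : ℕ) (l : Fin (L j)) :
    combine lam (fun _ => c) j l = c * weight lam j l := by
  rw [combine_apply, weight, Finset.mul_sum]

theorem combine_eq_linearCombination (lam : Fin K → ParamSpace L) :
    combine lam = Fintype.linearCombination ℝ lam := by
  ext g : 1
  rw [Fintype.linearCombination_apply, combine]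

theorem combine_add (lam : Fin K → ParamSpace L) (u v : Fin K → ℝ) :
    combine lam (u + v) = combine lam u + combine lam v := by
  rw [combine_eq_linearCombination, map_add]

theorem combine_smul (lam : Fin K → ParamSpace L) (c : ℝ) (u : Fin K → ℝ) :
    combine lam (c • u) = c • combine lam u := by
  rw [combine_eq_linearCombination, map_smul]

theorem info_smul (lam : Fin K → ParamSpace L) (j : ℕ) (c : ℝ) (v : Fin K → ℝ) :
    info lam j (c • v) = c ^ 2 * info lam j v := by
  rw [info, info, Finset.mul_sum]
  refine Finset.sum_congr rfl fun l _ => ?_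
  rw [combine_smul, Pi.smul_apply, Pi.smul_apply, smul_eq_mul]
  ring

theorem continuous_info (lam : Fin K → ParamSpace L) (j : ℕ) : Continuous (info lam j) := by
  unfold info
  simp only [combine_apply]
  fun_prop

/-! ### Divergence of the information -/

section

variable {lam : Fin K → ParamSpace L} (hmem : ∀ k, lam k ∈ body L)
include hmem

/-- The second moment of the likelihood ratio of `X_j` for the parameters `(1/K, …, 1/K) + v` and
`(1/K, …, 1/K)`. -/
theorem sum_sq_div_barycentre (hK : (0 : ℝ) < K) {v : Fin K → ℝ} (hv : ∑ k, v k = 0) (j : ℕ) :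
    ∑ l, combine lam ((fun _ => (K : ℝ)⁻¹) + v) j l ^ 2 / combine lam (fun _ => (K : ℝ)⁻¹) j l =
      1 + K * info lam j v := by
  have h : ∀ l, combine lam ((fun _ => (K : ℝ)⁻¹) + v) j l ^ 2 /
      combine lam (fun _ => (K : ℝ)⁻¹) j l = (K : ℝ)⁻¹ * weight lam j l + 2 * combine lam v j l +
        K * (combine lam v j l ^ 2 / weight lam j l) := by
    intro l
    rw [combine_add, Pi.add_apply, Pi.add_apply, combine_const]
    by_cases h : weight lam j l = 0
    · simp [h, combine_eq_zero_of_weight_eq_zero hmem v h]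
    · field_simp
      ring
  simp_rw [h, Finset.sum_add_distrib, ← Finset.mul_sum]
  rw [sum_weight hmem, sum_combine hmem, hv, info]
  field_simp
  ring

theorem not_summable_info
    (hsing : ∀ g' g'' : paramSet lam, g' ≠ g'' →
      (mixComponent lam g').MutuallySingular (mixComponent lam g''))
    {v : Fin K → ℝ} (hv : v ≠ 0) : ¬ Summable fun j => info lam j v := by
  intro hsum
  have hK : (0 : ℝ) < K := by
    rcases Nat.eq_zero_or_pos K with rfl | h
    · exact absurd (Subsingleton.elim v 0) hv
    · exact_mod_cast h
  by_cases hs : ∑ k, v k = 0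
  · have hvn : 0 < ‖v‖ := norm_pos_iff.2 hv
    -- This step length keeps every coordinate `1/K + ε * v k` nonnegative.
    set ε : ℝ := (K * ‖v‖)⁻¹ with hε
    have hεpos : 0 < ε := by positivity
    have hs' : ∑ k, (ε • v) k = 0 := by
      simp only [Pi.smul_apply, smul_eq_mul, ← Finset.mul_sum, hs, mul_zero]
    have h0 : (fun _ => (K : ℝ)⁻¹) ∈ paramSet lam :=
      mem_paramSet_of_nonneg hmem (fun _ => by positivity) (by simp [hK.ne'])
    have h1 : (fun _ => (K : ℝ)⁻¹) + ε • v ∈ paramSet lam := by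
      refine mem_paramSet_of_nonneg hmem (fun k => ?_) ?_
      · have h := neg_le_of_abs_le (norm_le_pi_norm v k)
        have h' : ε * ‖v‖ = (K : ℝ)⁻¹ := by rw [hε]; field_simp
        simp only [Pi.add_apply, Pi.smul_apply, smul_eq_mul]
        nlinarith [mul_le_mul_of_nonneg_left h hεpos.le]
      · simp only [Pi.add_apply, Finset.sum_add_distrib, hs']
        simp [hK.ne']
    refine not_mutuallySingular_of_prod_le ((mem_paramSet_iff _ _).1 h0)
      ((mem_paramSet_iff _ _).1 h1) (fun j l h => ?_)
      (M := Real.exp (∑' j, K * info lam j (ε • v))) (fun s => ?_) (hsing ⟨_, h0⟩ ⟨_, h1⟩ ?_)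
    · rw [combine_const] at h
      exact combine_eq_zero_of_weight_eq_zero hmem _
        ((mul_eq_zero.1 h).resolve_left (by positivity))
    · simp_rw [sum_sq_div_barycentre hmem hK hs']
      have hnn : ∀ j, 0 ≤ K * info lam j (ε • v) :=
        fun j => mul_nonneg hK.le (info_nonneg hmem j _)
      refine (Finset.prod_le_prod (fun j _ => by linarith [hnn j]) fun j _ => ?_).trans
        (b := ∏ j ∈ s, Real.exp (K * info lam j (ε • v))) ?_
      · rw [add_comm]
        exact Real.add_one_le_exp _
      · rw [← Real.exp_sum]
        refine Real.exp_le_exp.2 (Summable.sum_le_tsum s (fun j _ => hnn j) ?_)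
        simp_rw [info_smul]
        exact (hsum.mul_left _).mul_left _
    · intro h
      have h' : ε • v = 0 := left_eq_add.1 (Subtype.ext_iff.1 h)
      exact hv ((smul_eq_zero.1 h').resolve_left hεpos.ne')
  · have hpos : 0 < (∑ k, v k) ^ 2 / K := by positivity
    have := ge_of_tendsto' hsum.tendsto_atTop_zero fun j =>
      (div_le_iff₀ hK).2 (sq_sum_le_info hmem j v)
    linarith

/-- On the unit sphere the partial sums are continuous and increase to infinity, so compactness
gives a uniform `N`; homogeneity does the rest. -/
theorem exists_block_info
    (hinfo : ∀ v : Fin K → ℝ, v ≠ 0 → ¬ Summable fun j => info lam j v) (m : ℕ) (c : ℝ) :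
    ∃ N, ∀ v, c * ‖v‖ ^ 2 ≤ ∑ j ∈ Finset.Ico m N, info lam j v := by
  have hmono : ∀ v, Monotone fun N => ∑ j ∈ Finset.Ico m N, info lam j v := fun v N N' h =>
    Finset.sum_le_sum_of_subset_of_nonneg (Finset.Ico_subset_Ico_right h)
      fun j _ _ => info_nonneg hmem j v
  have hcover : Metric.sphere (0 : Fin K → ℝ) 1 ⊆
      ⋃ N : ℕ, {v | c < ∑ j ∈ Finset.Ico m N, info lam j v} := by
    intro v hv
    have hv0 : v ≠ 0 := by
      rintro rfl
      simp at hv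
    have ht := (not_summable_iff_tendsto_nat_atTop_of_nonneg
      (fun j => info_nonneg hmem j v)).1 (hinfo v hv0)
    obtain ⟨N, hN, hmN⟩ := ((ht.eventually_gt_atTop
      (c + ∑ j ∈ Finset.range m, info lam j v)).and (eventually_ge_atTop m)).exists
    rw [Set.mem_iUnion]
    refine ⟨N, ?_⟩
    rw [Set.mem_ofPred_eq, Finset.sum_Ico_eq_sub _ hmN]
    linarith
  obtain ⟨N, hN⟩ := (isCompact_sphere (0 : Fin K → ℝ) 1).elim_directed_cover
    (fun N : ℕ => {v | c < ∑ j ∈ Finset.Ico m N, info lam j v})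
    (fun N => isOpen_lt continuous_const (continuous_finsetSum _ fun j _ => continuous_info lam j))
    hcover
    (directed_of_isDirected_le fun N N' h v hv => lt_of_lt_of_le hv (hmono v h))
  refine ⟨N, fun v => ?_⟩
  by_cases hv : v = 0
  · subst hv
    simpa using Finset.sum_nonneg fun j _ => info_nonneg hmem j 0
  · have hvn : 0 < ‖v‖ := norm_pos_iff.2 hv
    have h : c < ∑ j ∈ Finset.Ico m N, info lam j (‖v‖⁻¹ • v) :=
      hN (by simp [norm_smul, hvn.ne'])
    simp_rw [info_smul, ← Finset.mul_sum] at h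
    have h' := mul_le_mul_of_nonneg_right h.le (sq_nonneg ‖v‖)
    rwa [mul_right_comm, ← mul_pow, inv_mul_cancel₀ hvn.ne', one_pow, one_mul] at h'

end

/-! ### Linear estimators on a block -/

/-- The polarization of the quadratic form `info` of the block `s` of coordinates. -/
noncomputable def infoForm (lam : Fin K → ParamSpace L) (s : Finset ℕ) (u v : Fin K → ℝ) : ℝ :=
  ∑ j ∈ s, ∑ l, combine lam v j l * (combine lam u j l / weight lam j l)

theorem infoForm_self (lam : Fin K → ParamSpace L) (s : Finset ℕ) (u : Fin K → ℝ) :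
    infoForm lam s u u = ∑ j ∈ s, info lam j u := by
  refine Finset.sum_congr rfl fun j _ => Finset.sum_congr rfl fun l _ => ?_
  ring

/-- The linear map of the form `infoForm`. -/
noncomputable def infoMap (lam : Fin K → ParamSpace L) (s : Finset ℕ) :
    (Fin K → ℝ) →ₗ[ℝ] (Fin K → ℝ) where
  toFun u k := ∑ j ∈ s, ∑ l, lam k j l * (combine lam u j l / weight lam j l)
  map_add' u v := by
    ext k
    simp only [combine_add, Pi.add_apply, add_div, mul_add, Finset.sum_add_distrib]
  map_smul' c u := by
    ext k
    simp only [combine_smul, Pi.smul_apply, smul_eq_mul, RingHom.id_apply, Finset.mul_sum]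
    refine Finset.sum_congr rfl fun j _ => Finset.sum_congr rfl fun l _ => ?_
    ring

theorem infoForm_eq_sum (lam : Fin K → ParamSpace L) (s : Finset ℕ) (u v : Fin K → ℝ) :
    infoForm lam s u v = ∑ k, v k * infoMap lam s u k := by
  simp only [infoForm, infoMap, LinearMap.coe_mk, AddHom.coe_mk, Finset.mul_sum]
  rw [Finset.sum_comm]
  refine Finset.sum_congr rfl fun j _ => ?_
  rw [Finset.sum_comm]
  refine Finset.sum_congr rfl fun l _ => ?_
  rw [combine_apply lam v, Finset.sum_mul]
  exact Finset.sum_congr rfl fun k _ => mul_assoc _ _ _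

/-- The coefficients of an unbiased linear estimator of `g_k` from the coordinates in `s`. -/
theorem exists_infoForm_eq {lam : Fin K → ParamSpace L} {s : Finset ℕ} {c : ℝ} (hc : 0 < c)
    (hs : ∀ v, c * ‖v‖ ^ 2 ≤ ∑ j ∈ s, info lam j v) (k : Fin K) :
    ∃ u, (∀ g, infoForm lam s u g = g k) ∧ ∑ j ∈ s, info lam j u ≤ 1 / c := by
  have hinj : Function.Injective (infoMap lam s) := by
    rw [← LinearMap.ker_eq_bot, LinearMap.ker_eq_bot']
    intro u hu
    have h := hs u
    rw [← infoForm_self, infoForm_eq_sum, hu] at h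
    simp only [Pi.zero_apply, mul_zero, Finset.sum_const_zero] at h
    have h0 : ‖u‖ ^ 2 = 0 := le_antisymm (nonpos_of_mul_nonpos_right h hc) (sq_nonneg _)
    simpa using h0
  obtain ⟨u, hu⟩ := LinearMap.injective_iff_surjective.1 hinj (Pi.single k 1)
  have hg : ∀ g, infoForm lam s u g = g k := by
    intro g
    rw [infoForm_eq_sum, hu]
    simp [Pi.single_apply]
  refine ⟨u, hg, ?_⟩
  have h := hs u
  -- Applying the unbiasedness identity to `u` itself turns its information into the coordinate `u
  -- k`.
  have h1 : ∑ j ∈ s, info lam j u ≤ ‖u‖ := by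
    rw [← infoForm_self, hg]
    exact (le_abs_self _).trans (norm_le_pi_norm u k)
  have h2 : c * ‖u‖ ≤ 1 := by
    rcases (norm_nonneg u).eq_or_lt with h0 | h0
    · simp [← h0]
    · exact le_of_mul_le_mul_right (by linarith [sq ‖u‖, mul_assoc c ‖u‖ ‖u‖]) h0
  rw [le_div_iff₀ hc, mul_comm]
  exact (mul_le_mul_of_nonneg_left h1 hc.le).trans h2

/-- The linear statistic of the coordinates in `s` with coefficients `u`. -/
noncomputable def linStat (lam : Fin K → ParamSpace L) (s : Finset ℕ) (u : Fin K → ℝ)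
    (a : Outcomes L) : ℝ :=
  ∑ j ∈ s, combine lam u j (a j) / weight lam j (a j)

theorem measurable_linStat_fromIndex (lam : Fin K → ParamSpace L) {s : Finset ℕ}
    (u : Fin K → ℝ) {n : ℕ} (hs : ∀ j ∈ s, n ≤ j) :
    Measurable[fromIndex L n] (linStat lam s u) := by
  refine @Finset.measurable_fun_sum _ _ _ _ _ _ (fromIndex L n) _ s fun j hj => ?_
  have hj' : Measurable[fromIndex L n] fun a : Outcomes L => a j :=
    (comap_measurable fun a : Outcomes L => a j).mono
      (le_iSup₂ (f := fun (j : ℕ) (_ : n ≤ j) =>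
        MeasurableSpace.comap (fun a : Outcomes L => a j) inferInstance) j (hs j hj)) le_rfl
  exact (measurable_of_finite fun l : Fin (L j) =>
    combine lam u j l / weight lam j l).comp hj'

theorem measurable_linStat (lam : Fin K → ParamSpace L) (s : Finset ℕ) (u : Fin K → ℝ) :
    Measurable (linStat lam s u) := by
  refine Finset.measurable_fun_sum s fun j _ => ?_
  exact (measurable_of_finite fun l : Fin (L j) =>
    combine lam u j l / weight lam j l).comp (measurable_pi_apply j)

/-! ### Variance and almost sure convergence -/

section

variable {lam : Fin K → ParamSpace L} (hmem : ∀ k, lam k ∈ body L)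

theorem memLp_coord {β : ParamSpace L} (hβ : β ∈ body L) (j : ℕ) (f : Fin (L j) → ℝ) :
    MemLp (fun a => f (a j)) 2 (indepMeasure β) := by
  have := isProbabilityMeasure_coordMeasure hβ
  exact (MemLp.of_discrete (f := f) (μ := coordMeasure β j)).comp_measurePreserving
    (measurePreserving_eval_infinitePi (coordMeasure β) j)

theorem integral_coord {β : ParamSpace L} (hβ : β ∈ body L) (j : ℕ) (f : Fin (L j) → ℝ) :
    ∫ a, f (a j) ∂indepMeasure β = ∑ l, β j l * f l := by
  have := isProbabilityMeasure_coordMeasure hβ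
  rw [← integral_coordMeasure hβ, indepMeasure,
    ← (measurePreserving_eval_infinitePi (coordMeasure β) j).map_eq,
    integral_map (measurable_pi_apply j).aemeasurable
      (measurable_of_finite f).aestronglyMeasurable]

theorem integral_linStat {g : Fin K → ℝ} (hg : g ∈ paramSet lam) (s : Finset ℕ)
    (u : Fin K → ℝ) :
    ∫ a, linStat lam s u a ∂indepMeasure (combine lam g) = infoForm lam s u g := by
  have hβ := (mem_paramSet_iff _ _).1 hg
  have := isProbabilityMeasure_indepMeasure hβ
  unfold linStat
  rw [integral_finsetSum _ fun j _ => (memLp_coord hβ j fun l =>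
    combine lam u j l / weight lam j l).integrable (by norm_num)]
  exact Finset.sum_congr rfl fun j _ => integral_coord hβ j fun l =>
    combine lam u j l / weight lam j l

include hmem in
-- Independence makes variances add, and each probability under `P_g` is at most `‖g‖` times the
-- weight.
theorem variance_linStat_le {g : Fin K → ℝ} (hg : g ∈ paramSet lam) (s : Finset ℕ)
    (u : Fin K → ℝ) :
    Var[linStat lam s u; indepMeasure (combine lam g)] ≤ ‖g‖ * ∑ j ∈ s, info lam j u := by
  have hβ := (mem_paramSet_iff _ _).1 hg
  have := isProbabilityMeasure_coordMeasure hβ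
  have := isProbabilityMeasure_indepMeasure hβ
  set f : (j : ℕ) → Fin (L j) → ℝ := fun j l => combine lam u j l / weight lam j l with hf
  have hsum : linStat lam s u = ∑ j ∈ s, fun a : Outcomes L => f j (a j) := by
    ext a
    simp [linStat, hf]
  have hind : iIndepFun (fun j (a : Outcomes L) => f j (a j)) (indepMeasure (combine lam g)) :=
    iIndepFun_infinitePi fun j => measurable_of_finite (f j)
  rw [hsum, IndepFun.variance_sum (fun j _ => memLp_coord hβ j (f j))
    fun i _ j _ hij => hind.indepFun hij, Finset.mul_sum]
  refine Finset.sum_le_sum fun j _ => ?_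
  refine (variance_le_expectation_sq (memLp_coord hβ j (f j)).aestronglyMeasurable).trans ?_
  refine (integral_coord hβ j fun l => f j l ^ 2).trans_le ?_
  rw [info, Finset.mul_sum]
  refine Finset.sum_le_sum fun l _ => ?_
  -- At weight zero both quotients are zero, as division by zero gives `0`.
  by_cases h : weight lam j l = 0
  · simp [hf, h]
  · have h1 := mul_le_mul_of_nonneg_right ((le_abs_self _).trans (abs_combine_le hmem g j l))
      (sq_nonneg (f j l))
    refine h1.trans_eq ?_
    simp only [hf]
    field_simp

/-- Unbiased linear statistics with summable variances converge almost surely. -/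
theorem ae_tendsto_linStat {g : Fin K → ℝ} {k : Fin K} {s : ℕ → Finset ℕ} {u : ℕ → Fin K → ℝ}
    (hmem : ∀ k, lam k ∈ body L) (hg : g ∈ paramSet lam)
    (hu : ∀ n, infoForm lam (s n) (u n) g = g k)
    (hi : ∀ n, ∑ j ∈ s n, info lam j (u n) ≤ (1 / 2) ^ n) :
    ∀ᵐ a ∂indepMeasure (combine lam g),
      Tendsto (fun n => linStat lam (s n) (u n) a) atTop (𝓝 (g k)) := by
  have hβ := (mem_paramSet_iff _ _).1 hg
  have := isProbabilityMeasure_indepMeasure hβ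
  have hmeas : ∀ n, Measurable fun a => ENNReal.ofReal ((linStat lam (s n) (u n) a - g k) ^ 2) :=
    fun n => (((measurable_linStat lam (s n) (u n)).sub_const _).pow_const 2).ennreal_ofReal
  have hLp : ∀ n, MemLp (linStat lam (s n) (u n)) 2 (indepMeasure (combine lam g)) := fun n =>
    memLp_finsetSum _ fun j _ => memLp_coord hβ j fun l =>
      combine lam (u n) j l / weight lam j l
  have hbound : ∀ n, ∫⁻ a, ENNReal.ofReal ((linStat lam (s n) (u n) a - g k) ^ 2)
      ∂indepMeasure (combine lam g) ≤ ENNReal.ofReal (‖g‖ * (1 / 2) ^ n) := by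
    intro n
    have h := evariance_eq_lintegral_ofReal (μ := indepMeasure (combine lam g))
      (linStat lam (s n) (u n))
    rw [integral_linStat hg, hu] at h
    rw [← h, ← (hLp n).ofReal_variance_eq]
    exact ENNReal.ofReal_le_ofReal ((variance_linStat_le hmem hg _ _).trans
      (mul_le_mul_of_nonneg_left (hi n) (norm_nonneg g)))
  -- The total squared error has finite expectation, hence is almost surely finite; overlapping
  -- blocks do no harm.
  have hfin : ∫⁻ a, ∑' n, ENNReal.ofReal ((linStat lam (s n) (u n) a - g k) ^ 2)
      ∂indepMeasure (combine lam g) ≠ ∞ := by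
    rw [lintegral_tsum fun n => (hmeas n).aemeasurable]
    refine ne_top_of_le_ne_top ?_ (ENNReal.tsum_le_tsum hbound)
    have hsum : Summable fun n : ℕ => ‖g‖ * (1 / 2 : ℝ) ^ n := summable_geometric_two.mul_left _
    rw [← ENNReal.ofReal_tsum_of_nonneg (fun n => by positivity) hsum]
    exact ENNReal.ofReal_ne_top
  filter_upwards [ae_lt_top (Measurable.tsum hmeas) hfin] with a ha
  have h0 := ENNReal.tendsto_atTop_zero_of_tsum_ne_top ha.ne
  have h1 := (ENNReal.tendsto_toReal ENNReal.zero_ne_top).comp h0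
  have h2 : Tendsto (fun n => (linStat lam (s n) (u n) a - g k) ^ 2) atTop (𝓝 0) := by
    simpa [Function.comp_def, ENNReal.toReal_ofReal (sq_nonneg _)] using h1
  have h3 : Tendsto (fun n => linStat lam (s n) (u n) a - g k) atTop (𝓝 0) := by
    rw [tendsto_zero_iff_abs_tendsto_zero]
    simpa [Function.comp_def, Real.sqrt_sq_eq_abs] using h2.sqrt
  simpa using h3.add_const (g k)

end

/-! ### Tail measurability and conclusion -/

/-- Dropping the first `N` terms does not change the limsup, and the remaining ones depend only on
coordinates from `N` on. -/
theorem measurable_limsup_tail {T : ℕ → Outcomes L → ℝ}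
    (hT : ∀ n, Measurable[fromIndex L n] (T n)) :
    Measurable[tail L] fun a => limsup (fun n => T n a) atTop := by
  have hanti : ∀ m n, m ≤ n → fromIndex L n ≤ fromIndex L m := fun m n hmn =>
    iSup₂_le fun j hj => le_iSup₂ (f := fun (j : ℕ) (_ : m ≤ j) =>
      MeasurableSpace.comap (fun a : Outcomes L => a j) inferInstance) j (hmn.trans hj)
  intro A hA
  rw [MeasurableSpace.measurableSet_iInf]
  intro N
  have h : (fun a => limsup (fun n => T n a) atTop) =
      fun a => limsup (fun n => T (n + N) a) atTop :=
    funext fun a => (limsup_nat_add (fun n => T n a) N).symm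
  rw [h]
  exact Measurable.limsup (mδ := fromIndex L N)
    (fun n => (hT (n + N)).mono (hanti _ _ (Nat.le_add_left _ _)) le_rfl) hA

end IndepMixture

open IndepMixture in
theorem mainTheorem5 (L : ℕ → ℕ) (K : ℕ) (lam : Fin K → ParamSpace L)
    (hlam : LinearIndependent ℝ lam) (hmem : ∀ k, lam k ∈ body L)
    (hsing : ∀ g' g'' : paramSet lam, g' ≠ g'' →
      (mixComponent lam g').MutuallySingular (mixComponent lam g''))
    (μ : Measure (paramSet lam)) (hμ : IsProbabilityMeasure μ) :
    ∃ Q₁ : Set (paramSet lam), MeasurableSet Q₁ ∧ μ Q₁ = 1 ∧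
      ∃ φ : Outcomes L → paramSet lam,
        Measurable[tail L] φ ∧ Q₁ ⊆ Set.range φ ∧
          ∀ g ∈ Q₁, mixComponent lam g (φ ⁻¹' {g}) = 1 := by
  have hne : Nonempty (paramSet lam) := nonempty_of_isProbabilityMeasure μ
  choose N hN using fun n : ℕ => exists_block_info hmem
    (fun v hv => not_summable_info hmem hsing hv) n (2 ^ n)
  choose u hu hi using fun (k : Fin K) (n : ℕ) =>
    exists_infoForm_eq (pow_pos two_pos n) (hN n) k
  let T : Outcomes L → Fin K → ℝ := fun a k =>
    Filter.limsup (fun n => linStat lam (Finset.Ico n (N n)) (u k n) a) Filter.atTop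
  have hT : Measurable[tail L] T := by
    refine @measurable_pi_lambda _ _ _ (tail L) _ _ fun k => ?_
    exact measurable_limsup_tail fun n => measurable_linStat_fromIndex lam (u k n)
      fun j hj => (Finset.mem_Ico.1 hj).1
  -- `T` may leave `Q` on exceptional outcomes, so it is followed by a measurable retraction `ψ` of
  -- `ℝ^K` onto `Q`.
  obtain ⟨ψ, hψ, hψT⟩ := (MeasurableEmbedding.subtype_coe
    (measurableSet_paramSet lam)).exists_measurable_extend measurable_id fun _ => hne
  have hone : ∀ g : paramSet lam, mixComponent lam g ((ψ ∘ T) ⁻¹' {g}) = 1 := by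
    intro g
    have := isProbabilityMeasure_indepMeasure ((mem_paramSet_iff _ _).1 g.2)
    have hae : ∀ᵐ a ∂mixComponent lam g, T a = g := by
      have h : ∀ᵐ a ∂mixComponent lam g, ∀ k, Filter.Tendsto
          (fun n => linStat lam (Finset.Ico n (N n)) (u k n) a) Filter.atTop
          (nhds ((g : Fin K → ℝ) k)) :=
        ae_all_iff.2 fun k => ae_tendsto_linStat hmem g.2 (fun n => hu k n g)
          fun n => by simpa using hi k n
      filter_upwards [h] with a ha
      exact funext fun k => (ha k).limsup_eq
    have hcongr : (ψ ∘ T) ⁻¹' {g} =ᵐ[mixComponent lam g] Set.univ := by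
      rw [Filter.eventuallyEq_univ]
      filter_upwards [hae] with a h
      change ψ (T a) = g
      rw [h]
      exact congrFun hψT g
    rw [measure_congr hcongr]
    exact this.measure_univ
  refine ⟨Set.univ, MeasurableSet.univ, measure_univ, ψ ∘ T, hψ.comp hT, fun g _ => ?_,
    fun g _ => hone g⟩
  -- A fibre of probability 1 is nonempty, so `g` is attained.
  obtain ⟨a, ha⟩ := nonempty_of_measure_ne_zero ((hone g).trans_ne one_ne_zero)
  exact ⟨a, ha⟩
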